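/- Let $0<k_{\min}<k_{\max}$ and $K=[k_{\min},k_{\max}]$. Call $D\subset\mathbb{R}^3$ an obstacle if it is a nonempty bounded open set with Lipschitz boundary (locally, in suitable orthogonal coordinates, the region on one side of the graph of a Lipschitz function) whose exterior $\mathbb{R}^3\setminus\overline D$ is connected. Let $\nu$ be its unit outward normal, defined almost everywhere on $\partial D$. For unit vectors $\hat x,d,p$ and $k>0$ let $H^i(y,d,p,k)=(d\times p)\,e^{ik\,y\cdot d}$ and let $$E^\infty_{\mathrm{po}}(\hat x,d,p,k)=ik\,\hat x\times\int_{\partial D}\big[(\nu\times H_{\mathrm{po}})(y)\times\hat x\big]\,e^{-ik\,\hat x\cdot y}\,ds(y),\qquad \nu\times H_{\mathrm{po}}=\begin{cases}2\,\nu\times H^i,&\nu\cdot d<0,\\ 0,&\nu\cdot d\ge 0,\end{cases}$$ be the electric far field pattern of the perfect conductor $D$ in the physical optics approximation. For a unit vector $\theta$ let $$S_D(\theta)=\Big\{y\in\mathbb{R}^3:\ \inf_{z\in D}z\cdot\theta\le y\cdot\theta\le\sup_{z\in D}z\cdot\theta\Big\}.$$ Let $d,p,e\in\mathbb{R}^3$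 be unit vectors with $p\cdot d=0$ and $e\cdot p\neq0$. Then the strip $S_D(d)$ is uniquely determined by the scalar backscattering data $e\cdot E^\infty_{\mathrm{po}}(-d,d,p,k)$ and $e\cdot E^\infty_{\mathrm{po}}(d,-d,p,k)$, $k\in K$. That is, if $D_1,D_2$ are obstacles with physical optics far field patterns $E^\infty_{\mathrm{po},1},E^\infty_{\mathrm{po},2}$ and $$e\cdot E^\infty_{\mathrm{po},1}(-d,d,p,k)=e\cdot E^\infty_{\mathrm{po},2}(-d,d,p,k),\qquad e\cdot E^\infty_{\mathrm{po},1}(d,-d,p,k)=e\cdot E^\infty_{\mathrm{po},2}(d,-d,p,k)\qquad\text{for all }k\in K,$$ then $S_{D_1}(d)=S_{D_2}(d)$. -/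

import Mathlib

open MeasureTheory Topology
open scoped Matrix NNReal RealInnerProductSpace

noncomputable section

namespace PhysicalOptics

/-- Euclidean three-space. -/
abbrev E3 : Type := EuclideanSpace ℝ (Fin 3)

/-- The boundary of `D` is Lipschitz: near each boundary point, in suitable orthogonal coordinates
`(y', y₃) ∈ ℝ² × ℝ`, the set `D` is the region strictly below the graph of a Lipschitz function. -/
def HasLipschitzBoundary (D : Set E3) : Prop :=
  ∀ x ∈ frontier D,
    ∃ (T : E3 ≃ₗᵢ[ℝ] WithLp 2 (EuclideanSpace ℝ (Fin 2) × ℝ))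
      (γ : EuclideanSpace ℝ (Fin 2) → ℝ) (L : ℝ≥0) (U : Set E3),
      LipschitzWith L γ ∧ IsOpen U ∧ x ∈ U ∧ ∀ y ∈ U, (y ∈ D ↔ (T y).snd < γ (T y).fst)

/-- An obstacle: a nonempty bounded open set with Lipschitz boundary whose exterior is connected. -/
structure IsObstacle (D : Set E3) : Prop where
  isOpen : IsOpen D
  nonempty : D.Nonempty
  isBounded : Bornology.IsBounded D
  lipschitz : HasLipschitzBoundary D
  exterior_connected : IsConnected (closure D)ᶜ

/-- `n` is the unit outward normal to `D` at `y`: every circular cone with apex `y` and axis `-n`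
that is narrower than a half space is, near `y`, inside `D`, and every such cone with axis `n` is,
near `y`, outside `D` (apex excluded). Where the boundary is locally the graph of a function, this
is the usual normal at each point where that function is differentiable. -/
def IsOutwardNormal (D : Set E3) (y n : E3) : Prop :=
  ‖n‖ = 1 ∧ ∀ ε > 0, ∀ᶠ z in 𝓝 y,
    (⟪n, z - y⟫ < -(ε * ‖z - y‖) → z ∈ D) ∧ (ε * ‖z - y‖ < ⟪n, z - y⟫ → z ∉ D)

/-- There is at most one unit outward normal at a point. -/
theorem IsOutwardNormal.unique {D : Set E3} {y m n : E3}
    (hm : IsOutwardNormal D y m) (hn : IsOutwardNormal D y n) : m = n := by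
  by_contra hne
  have hlt : ⟪m, n⟫ < 1 := (inner_lt_one_iff_real_of_norm_eq_one hm.1 hn.1).2 hne
  set w : E3 := n - m with hw
  have hw0 : w ≠ 0 := sub_ne_zero.2 (Ne.symm hne)
  have hwpos : 0 < ‖w‖ := norm_pos_iff.2 hw0
  have hmw : ⟪m, w⟫ = ⟪m, n⟫ - 1 := by
    rw [hw, inner_sub_right, real_inner_self_eq_norm_sq, hm.1]; norm_num
  have hnw : ⟪n, w⟫ = 1 - ⟪m, n⟫ := by
    rw [hw, inner_sub_right, real_inner_self_eq_norm_sq, hn.1, real_inner_comm n m]; norm_num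
  set c : ℝ := 1 - ⟪m, n⟫ with hc
  have hcpos : 0 < c := by linarith
  set ε : ℝ := c / (2 * ‖w‖) with hε
  have hεpos : 0 < ε := by positivity
  have hεw : ε * ‖w‖ = c / 2 := by rw [hε]; field_simp
  have hev := (hm.2 ε hεpos).and (hn.2 ε hεpos)
  have hline : Filter.Tendsto (fun t : ℝ => y + t • w) (𝓝[>] 0) (𝓝 y) := by
    have : ContinuousAt (fun t : ℝ => y + t • w) 0 := by fun_prop
    have h2 := this.tendsto
    simp only [zero_smul, add_zero] at h2
    exact h2.mono_left nhdsWithin_le_nhds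
  obtain ⟨t, ht, htpos⟩ := ((hline.eventually hev).and self_mem_nhdsWithin).exists
  have htpos' : 0 < t := htpos
  have hnorm : ‖t • w‖ = t * ‖w‖ := by rw [norm_smul, Real.norm_of_nonneg htpos'.le]
  simp only [add_sub_cancel_left, inner_smul_right, hnorm] at ht
  have hmul : ε * (t * ‖w‖) = t * (c / 2) := by rw [← hεw]; ring
  rw [hmul, hmw, hnw] at ht
  exact ht.2.2 (by nlinarith) (ht.1.1 (by nlinarith))

open Classical in
/-- The unit outward normal field `ν`, set to `0` where no normal exists (for a Lipschitz boundary,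
a set of surface measure zero). -/
def outwardNormal (D : Set E3) (y : E3) : E3 :=
  if h : ∃ n, IsOutwardNormal D y n then h.choose else 0

/-- A real vector, regarded as a vector in `ℂ³`. -/
def toComplex (v : E3) : Fin 3 → ℂ := fun i => ((v i : ℝ) : ℂ)

/-- Magnetic field `(d × p) exp(i k y·d)` of the incident plane wave with direction `d` and
polarization `p`. -/
def incidentH (d p : E3) (k : ℝ) (y : E3) : Fin 3 → ℂ :=
  Complex.exp (Complex.I * k * (⟪y, d⟫ : ℝ)) • (toComplex d ⨯₃ toComplex p)

/-- The physical optics approximation of `ν × H` on `∂D`: it equals `2 ν × Hⁱ` on the illuminated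
part `ν·d < 0`, and `0` on the shadow part. -/
def poCurrent (D : Set E3) (d p : E3) (k : ℝ) (y : E3) : Fin 3 → ℂ :=
  if ⟪outwardNormal D y, d⟫ < 0 then
    (2 : ℂ) • (toComplex (outwardNormal D y) ⨯₃ incidentH d p k y)
  else 0

/-- The electric far field pattern in the physical optics approximation,
`i k x̂ × ∫_{∂D} (ν × H_po)(y) × x̂ exp(-i k x̂·y) ds(y)`, where `ds` is surface area, i.e. the
two-dimensional Hausdorff measure normalized to agree with Lebesgue measure on planes. -/
def poFarField (D : Set E3) (xhat d p : E3) (k : ℝ) : Fin 3 → ℂ :=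
  (Complex.I * k) • (toComplex xhat ⨯₃
    ∫ y in frontier D,
      Complex.exp (-(Complex.I * k * (⟪xhat, y⟫ : ℝ))) • (poCurrent D d p k y ⨯₃ toComplex xhat)
        ∂(μHE[2] : Measure E3))

/-- The strip hull of `D` in direction `θ`. -/
def strip (D : Set E3) (θ : E3) : Set E3 :=
  {y | sInf ((fun z => ⟪z, θ⟫) '' D) ≤ ⟪y, θ⟫ ∧ ⟪y, θ⟫ ≤ sSup ((fun z => ⟪z, θ⟫) '' D)}

end PhysicalOptics

end

noncomputable section

namespace PhysicalOptics

/-! In the backscattering direction the vector products collapse (`poFarField_neg_self`): the far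
field is `2ik p` times the integral over `∂D` of `(-ν·d)⁺ exp(2ik y·d)`. Since `e·p ≠ 0` and `k ≠
0`, the scalar data give this integral. It is the Fourier transform, at frequency `2k`, of
`illuminationMeasure D d`, the image of `(-ν·d)⁺ ds` under the height `y ↦ y·d`.

This is a finite positive measure carried by a bounded interval, so its transform is entire; its
values for `k` in an interval determine it everywhere, hence determine the measure.

The measure starts exactly at `inf_D z·d` (`illuminationMeasure_Iio_eq_zero_iff`). By positivity
nothing cancels, so it suffices that below every height `c > inf_D z·d` the illuminated boundary has
positive area (`measure_illuminated_ne_zero`). Points of `D` below `c` form a nonempty open set,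
whose projection along `d` has positive area. Moving each of them in direction `-d` until it leaves
`D` keeps the projection and lowers the height. Exit points that are not illuminated project to a
null set (`volume_image_dark`): off a null set, `ν` is orthogonal to `d` there, so the projection of
the graph has singular derivative.

Incidence from `-d` yields the supremum in the same way. -/

/-- The Euclidean plane. -/
abbrev E2 : Type := EuclideanSpace ℝ (Fin 2)

/-! ### Surface area under Lipschitz maps -/

/-- Lipschitz maps send sets of vanishing area to sets of vanishing area. -/
theorem euclideanHausdorffMeasure_image_eq_zero {X Y : Type*} [EMetricSpace X] [MeasurableSpace X]
    [BorelSpace X] [EMetricSpace Y] [MeasurableSpace Y] [BorelSpace Y] {K : ℝ≥0} {f : X → Y}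
    (hf : LipschitzWith K f) {s : Set X} (hs : (μHE[2] : Measure X) s = 0) :
    (μHE[2] : Measure Y) (f '' s) = 0 := by
  -- `μHE[2]` is a nonzero finite multiple of `μH[2]`, so null sets are the same for both.
  have h0 := Measure.addHaarScalarFactor_volume_hausdorffMeasure_ne_zero 2
  rw [Measure.euclideanHausdorffMeasure_def, Measure.smul_apply, ENNReal.smul_def, smul_eq_mul,
    mul_eq_zero] at hs ⊢
  right
  have hs' := hs.resolve_left (by simpa using h0)
  have := hf.hausdorffMeasure_image_le (d := ((2 : ℕ) : ℝ)) (by simp) s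
  rw [hs', mul_zero] at this
  exact nonpos_iff_eq_zero.1 this

/-- Lipschitz maps send sets of finite area to sets of finite area. -/
theorem euclideanHausdorffMeasure_image_lt_top {X Y : Type*} [EMetricSpace X] [MeasurableSpace X]
    [BorelSpace X] [EMetricSpace Y] [MeasurableSpace Y] [BorelSpace Y] {K : ℝ≥0} {f : X → Y}
    (hf : LipschitzWith K f) {s : Set X} (hs : (μHE[2] : Measure X) s < ⊤) :
    (μHE[2] : Measure Y) (f '' s) < ⊤ := by
  have h0 := Measure.addHaarScalarFactor_volume_hausdorffMeasure_ne_zero 2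
  rw [Measure.euclideanHausdorffMeasure_def, Measure.smul_apply, ENNReal.smul_def,
    smul_eq_mul] at hs ⊢
  have hs' : (μH[((2 : ℕ) : ℝ)] : Measure X) s < ⊤ :=
    ENNReal.lt_top_of_mul_ne_top_right hs.ne (by simpa using h0)
  refine ENNReal.mul_lt_top ENNReal.coe_lt_top
    ((hf.hausdorffMeasure_image_le (d := ((2 : ℕ) : ℝ)) (by simp) s).trans_lt ?_)
  refine ENNReal.mul_lt_top ?_ hs'
  exact ENNReal.rpow_lt_top_of_nonneg (by simp) ENNReal.coe_ne_top

/-! ### Lipschitz graph charts: normals and projections -/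

section Chart

variable (T : E3 ≃ₗᵢ[ℝ] WithLp 2 (E2 × ℝ)) (γ : E2 → ℝ)

/-- The parametrization of the graph of `γ` in the coordinates `T`. -/
def graphMap (x : E2) : E3 := T.symm (WithLp.toLp 2 (x, γ x))

/-- The upward normal `(-∇γ, 1)` to the graph of `γ` in the coordinates `T`, not normalized. -/
def graphNormal (x : E2) : E3 := T.symm (WithLp.toLp 2 (-gradient γ x, 1))

variable {T γ}

theorem graphMap_lipschitz {L : ℝ≥0} (hγ : LipschitzWith L γ) :
    ∃ K, LipschitzWith K (graphMap T γ) := by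
  have h1 : LipschitzWith (max 1 L) fun x : E2 => (x, γ x) := LipschitzWith.id.prodMk hγ
  exact ⟨_, T.symm.lipschitz.comp
    ((WithLp.prod_lipschitzWith_toLp 2 E2 ℝ).comp h1)⟩

theorem graphNormal_ne_zero (x : E2) : graphNormal T γ x ≠ 0 := by
  intro h
  simp [graphNormal] at h

theorem inner_graphNormal (x : E2) (v : E3) :
    ⟪graphNormal T γ x, v⟫ = (T v).snd - fderiv ℝ γ x (T v).fst := by
  rw [graphNormal, ← T.inner_map_map, T.apply_symm_apply, WithLp.prod_inner_apply]
  simp [gradient, sub_eq_neg_add]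

theorem measurable_graphNormal : Measurable (graphNormal T γ) := by
  have h1 : Measurable (gradient γ) :=
    (InnerProductSpace.toDual ℝ E2).symm.continuous.measurable.comp (measurable_fderiv ℝ γ)
  have h2 : Continuous fun g : E2 => T.symm (WithLp.toLp 2 (-g, (1 : ℝ))) := by fun_prop
  exact h2.measurable.comp h1

/-- `D` is the region below the graph of the Lipschitz function `γ` in the open set `U`. -/
structure IsGraphChart (D : Set E3) (T : E3 ≃ₗᵢ[ℝ] WithLp 2 (E2 × ℝ)) (γ : E2 → ℝ)
    (U : Set E3) : Prop where
  lipschitz : ∃ L, LipschitzWith L γ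
  isOpen : IsOpen U
  mem_iff : ∀ y ∈ U, (y ∈ D ↔ (T y).snd < γ (T y).fst)

variable {D U : Set E3}

theorem IsGraphChart.continuous_height (h : IsGraphChart D T γ U) :
    Continuous fun y : E3 => γ (T y).fst := by
  obtain ⟨L, hL⟩ := h.lipschitz
  exact hL.continuous.comp (by fun_prop)

/-- A point below the graph would lie in the open set `D`, and a point strictly above it has a
neighbourhood that misses `D`. -/
theorem IsGraphChart.snd_eq (h : IsGraphChart D T γ U) (hD : IsOpen D) {y : E3} (hyU : y ∈ U)
    (hy : y ∈ frontier D) : (T y).snd = γ (T y).fst := by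
  rw [frontier, hD.interior_eq] at hy
  refine le_antisymm ?_ (not_lt.1 fun hlt => hy.2 ((h.mem_iff y hyU).2 hlt))
  by_contra! hlt
  have hc := h.continuous_height
  have hopen : IsOpen (U ∩ {z | γ (T z).fst < (T z).snd}) :=
    h.isOpen.inter (isOpen_lt hc (by fun_prop))
  obtain ⟨z, ⟨hzU, hz⟩, hzD⟩ := mem_closure_iff.1 hy.1 _ hopen ⟨hyU, hlt⟩
  exact lt_asymm hz ((h.mem_iff z hzU).1 hzD)

theorem IsGraphChart.graphMap_fst (h : IsGraphChart D T γ U) (hD : IsOpen D) {y : E3}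
    (hyU : y ∈ U) (hy : y ∈ frontier D) : graphMap T γ (T y).fst = y := by
  rw [graphMap, ← h.snd_eq hD hyU hy, T.symm_apply_eq]
  rfl

/-- Where the graph function is differentiable, its upward normal is the outward normal. -/
theorem IsGraphChart.isOutwardNormal (h : IsGraphChart D T γ U) (hD : IsOpen D) {y : E3}
    (hyU : y ∈ U) (hy : y ∈ frontier D) (hγ : DifferentiableAt ℝ γ (T y).fst) :
    IsOutwardNormal D y (‖graphNormal T γ (T y).fst‖⁻¹ • graphNormal T γ (T y).fst) := by
  set N := graphNormal T γ (T y).fst with hN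
  have hNpos : 0 < ‖N‖ := norm_pos_iff.2 (graphNormal_ne_zero _)
  refine ⟨by rw [norm_smul, norm_inv, norm_norm, inv_mul_cancel₀ hNpos.ne'], fun ε hε => ?_⟩
  -- The factor `‖N‖` compensates for the normalization of `N`.
  have hlin := hγ.hasFDerivAt.isLittleO.def (c := ε * ‖N‖) (by positivity)
  have hcont : Filter.Tendsto (fun z : E3 => (T z).fst) (𝓝 y) (𝓝 (T y).fst) :=
    Continuous.tendsto (by fun_prop) y
  filter_upwards [hcont.eventually hlin, h.isOpen.mem_nhds hyU] with z hz hzU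
  have hs := h.snd_eq hD hyU hy
  have hfst : ‖(T z).fst - (T y).fst‖ ≤ ‖z - y‖ := by
    have := WithLp.norm_fst_le E2 (T (z - y))
    rwa [T.norm_map, map_sub] at this
  have hin : ⟪‖N‖⁻¹ • N, z - y⟫ =
      ‖N‖⁻¹ * ((T z).snd - (T y).snd - fderiv ℝ γ (T y).fst ((T z).fst - (T y).fst)) := by
    rw [real_inner_smul_left, hN, inner_graphNormal, map_sub]
    rfl
  have hle : |γ (T z).fst - γ (T y).fst - fderiv ℝ γ (T y).fst ((T z).fst - (T y).fst)| ≤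
      ε * ‖N‖ * ‖z - y‖ := by
    rw [← Real.norm_eq_abs]
    exact hz.trans (by gcongr)
  rw [abs_le] at hle
  rw [hin, h.mem_iff z hzU, inv_mul_eq_div, div_lt_iff₀ hNpos, lt_div_iff₀ hNpos]
  constructor
  · intro hlt
    linarith [hle.1]
  · intro hlt
    linarith [hle.2]

theorem IsGraphChart.outwardNormal_eq (h : IsGraphChart D T γ U) (hD : IsOpen D) {y : E3}
    (hyU : y ∈ U) (hy : y ∈ frontier D) (hγ : DifferentiableAt ℝ γ (T y).fst) :
    outwardNormal D y = ‖graphNormal T γ (T y).fst‖⁻¹ • graphNormal T γ (T y).fst := by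
  have hn := h.isOutwardNormal hD hyU hy hγ
  have hex : ∃ n, IsOutwardNormal D y n := ⟨_, hn⟩
  rw [outwardNormal, dif_pos hex]
  exact hex.choose_spec.unique hn

/-- The part of the boundary over the points where `γ` is not differentiable has no area. -/
theorem IsGraphChart.measure_nondiff (h : IsGraphChart D T γ U) :
    (μHE[2] : Measure E3) (graphMap T γ '' {x | ¬ DifferentiableAt ℝ γ x}) = 0 := by
  obtain ⟨L, hL⟩ := h.lipschitz
  obtain ⟨K, hK⟩ := graphMap_lipschitz (T := T) hL
  apply euclideanHausdorffMeasure_image_eq_zero hK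
  rw [EuclideanSpace.euclideanHausdorffMeasure_eq_volume]
  exact hL.ae_differentiableAt (μ := volume)

/-- By Rademacher's theorem the normal, which is defined by choice, agrees off a null set with the
Borel field built from the gradient of `γ`. -/
theorem IsGraphChart.aemeasurable_outwardNormal (h : IsGraphChart D T γ U) (hD : IsOpen D) :
    AEMeasurable (outwardNormal D) ((μHE[2] : Measure E3).restrict (U ∩ frontier D)) := by
  refine ⟨fun y => ‖graphNormal T γ (T y).fst‖⁻¹ • graphNormal T γ (T y).fst, ?_, ?_⟩
  · have h1 : Measurable fun y : E3 => graphNormal T γ (T y).fst :=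
      measurable_graphNormal.comp (Continuous.measurable (by fun_prop))
    exact h1.norm.inv.smul h1
  · rw [Filter.EventuallyEq, ae_restrict_iff' (h.isOpen.measurableSet.inter
      isClosed_frontier.measurableSet)]
    refine measure_mono_null ?_ h.measure_nondiff
    intro y hy
    simp only [Set.mem_compl_iff, Set.mem_ofPred_eq, Classical.not_imp] at hy
    exact ⟨(T y).fst, fun hd => hy.2 (h.outwardNormal_eq hD hy.1.1 hy.1.2 hd),
      h.graphMap_fst hD hy.1.1 hy.1.2⟩

/-- Projecting along `d`, the part of the graph whose normal is orthogonal to `d` becomes null. -/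
theorem volume_image_tangential {d : E3} (hd : d ≠ 0)
    {P : E3 →L[ℝ] E2} (hP : P d = 0) :
    volume (P '' (graphMap T γ ''
      {x | DifferentiableAt ℝ γ x ∧ ⟪graphNormal T γ x, d⟫ = 0})) = 0 := by
  rw [Set.image_image]
  -- `M x` is the derivative of `P ∘ graphMap T γ` at `x`.
  set M : E2 → E2 →L[ℝ] E2 := fun x => P ∘L
    (T.symm.toContinuousLinearEquiv : WithLp 2 (E2 × ℝ) →L[ℝ] E3) ∘L
    ((WithLp.prodContinuousLinearEquiv 2 ℝ E2 ℝ).symm : E2 × ℝ →L[ℝ] WithLp 2 (E2 × ℝ)) ∘L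
    ((ContinuousLinearMap.id ℝ E2).prod (fderiv ℝ γ x)) with hM
  refine addHaar_image_eq_zero_of_det_fderivWithin_eq_zero volume (f' := M) ?_ ?_
  · rintro x ⟨hx, -⟩
    have h1 : HasFDerivAt (fun x : E2 => (x, γ x))
        ((ContinuousLinearMap.id ℝ E2).prod (fderiv ℝ γ x)) x :=
      (hasFDerivAt_id x).prodMk hx.hasFDerivAt
    exact (P.hasFDerivAt.comp x (T.symm.toContinuousLinearEquiv.hasFDerivAt.comp x
      ((WithLp.prodContinuousLinearEquiv 2 ℝ E2 ℝ).symm.hasFDerivAt.comp x h1))).hasFDerivWithinAt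
  · rintro x ⟨-, hx⟩
    rw [inner_graphNormal, sub_eq_zero] at hx
    -- Being orthogonal to the normal, `d` is tangent to the graph: it is the lift of `(T d).fst`.
    -- As `P d = 0`, this vector lies in the kernel of `M x`, and it is nonzero because `d` is.
    have hTd : T.symm (WithLp.toLp 2 ((T d).fst, fderiv ℝ γ x (T d).fst)) = d := by
      rw [← hx, T.symm_apply_eq]
      rfl
    by_contra hdet
    have hker : LinearMap.ker (M x : E2 →ₗ[ℝ] E2) = ⊥ := by
      by_contra hne
      exact hdet (LinearMap.det_eq_zero_iff_ker_ne_bot.2 hne)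
    have hmem : (T d).fst ∈ LinearMap.ker (M x : E2 →ₗ[ℝ] E2) := by
      rw [LinearMap.mem_ker]
      change P (T.symm (WithLp.toLp 2 ((T d).fst, fderiv ℝ γ x (T d).fst))) = 0
      rw [hTd, hP]
    rw [hker, Submodule.mem_bot] at hmem
    rw [hmem, map_zero] at hTd
    apply hd
    rw [← hTd]
    exact T.symm.map_zero

end Chart

/-! ### From charts to the whole boundary, by compactness -/

theorem IsObstacle.exists_chart {D : Set E3} (hD : IsObstacle D) {y : E3} (hy : y ∈ frontier D) :
    ∃ T γ U, IsGraphChart D T γ U ∧ y ∈ U := by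
  obtain ⟨T, γ, L, U, hL, hU, hyU, hmem⟩ := hD.lipschitz y hy
  exact ⟨T, γ, U, ⟨⟨L, hL⟩, hU, hmem⟩, hyU⟩

theorem IsObstacle.isCompact_frontier {D : Set E3} (hD : IsObstacle D) :
    IsCompact (frontier D) :=
  hD.isBounded.isCompact_closure.of_isClosed_subset isClosed_frontier frontier_subset_closure

/-- The boundary of an obstacle has finite area. -/
theorem IsObstacle.measure_frontier_lt_top {D : Set E3} (hD : IsObstacle D) :
    (μHE[2] : Measure E3) (frontier D) < ⊤ := by
  refine hD.isCompact_frontier.measure_lt_top_of_nhdsWithin fun y hy => ?_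
  obtain ⟨T, γ, U, h, hyU⟩ := hD.exists_chart hy
  obtain ⟨L, hL⟩ := h.lipschitz
  obtain ⟨K, hK⟩ := graphMap_lipschitz (T := T) hL
  refine ⟨Metric.ball y 1 ∩ U ∩ frontier D, Filter.inter_mem (mem_nhdsWithin_of_mem_nhds
    (Filter.inter_mem (Metric.ball_mem_nhds y one_pos) (h.isOpen.mem_nhds hyU)))
    self_mem_nhdsWithin, ?_⟩
  have hsub : Metric.ball y 1 ∩ U ∩ frontier D ⊆
      graphMap T γ '' (Metric.ball (T y).fst 1) := by
    rintro z ⟨⟨hz1, hzU⟩, hz⟩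
    refine ⟨(T z).fst, ?_, h.graphMap_fst hD.isOpen hzU hz⟩
    rw [mem_ball_iff_norm] at hz1 ⊢
    have := WithLp.norm_fst_le E2 (T (z - y))
    rw [T.norm_map, map_sub] at this
    exact this.trans_lt hz1
  refine (measure_mono hsub).trans_lt (euclideanHausdorffMeasure_image_lt_top hK ?_)
  rw [EuclideanSpace.euclideanHausdorffMeasure_eq_volume]
  exact measure_ball_lt_top

/-- The outward normal field is measurable with respect to surface area. -/
theorem IsObstacle.aemeasurable_outwardNormal {D : Set E3} (hD : IsObstacle D) :
    AEMeasurable (outwardNormal D) ((μHE[2] : Measure E3).restrict (frontier D)) := by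
  have := hD.isCompact_frontier.induction_on
    (p := fun s => AEMeasurable (outwardNormal D) ((μHE[2] : Measure E3).restrict s))
    (by simp) (fun s t hst ht => ht.mono_measure (Measure.restrict_mono hst le_rfl))
    (fun s t hs ht => aemeasurable_union_iff.2 ⟨hs, ht⟩)
    (fun y hy => ?_)
  · exact this
  · obtain ⟨T, γ, U, h, hyU⟩ := hD.exists_chart hy
    exact ⟨U ∩ frontier D, Filter.inter_mem (mem_nhdsWithin_of_mem_nhds (h.isOpen.mem_nhds hyU))
      self_mem_nhdsWithin, h.aemeasurable_outwardNormal hD.isOpen⟩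

/-! ### Exit points and the illuminated boundary -/

/-- If the ray from a boundary point in direction `d` starts inside `D`, then the outward normal
there does not point into the direction of `d`. -/
theorem IsOutwardNormal.inner_nonpos {D : Set E3} {y n d : E3} (hn : IsOutwardNormal D y n)
    (hd : ‖d‖ = 1) (hray : ∃ t > 0, ∀ s : ℝ, 0 < s → s ≤ t → y + s • d ∈ D) : ⟪n, d⟫ ≤ 0 := by
  by_contra! hpos
  obtain ⟨t, ht, hray⟩ := hray
  have hline : Filter.Tendsto (fun s : ℝ => y + s • d) (𝓝[>] 0) (𝓝 y) := by
    have h2 : Filter.Tendsto (fun s : ℝ => y + s • d) (𝓝 0) (𝓝 (y + (0 : ℝ) • d)) :=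
      Continuous.tendsto (by fun_prop) 0
    rw [zero_smul, add_zero] at h2
    exact h2.mono_left nhdsWithin_le_nhds
  obtain ⟨s, hs, hs0, hst⟩ := ((hline.eventually (hn.2 (⟪n, d⟫ / 2) (by positivity))).and
    (Ioc_mem_nhdsGT ht)).exists
  refine hs.2 ?_ (hray s hs0 hst)
  rw [add_sub_cancel_left, norm_smul, hd, real_inner_smul_right, Real.norm_of_nonneg hs0.le]
  nlinarith [mul_pos hs0 hpos]

/-- Projecting along `d`, the boundary points that are hit from inside `D` in direction `-d` but
are not illuminated form a null set. -/
theorem IsObstacle.volume_image_dark {D : Set E3} (hD : IsObstacle D) {d : E3} (hd : ‖d‖ = 1)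
    {P : E3 →L[ℝ] E2} (hP : P d = 0) :
    volume (P '' {y | y ∈ frontier D ∧
      (∃ t > 0, ∀ s : ℝ, 0 < s → s ≤ t → y + s • d ∈ D) ∧ ¬ ⟪outwardNormal D y, d⟫ < 0}) = 0 := by
  set B : Set E3 := {y | y ∈ frontier D ∧
    (∃ t > 0, ∀ s : ℝ, 0 < s → s ≤ t → y + s • d ∈ D) ∧ ¬ ⟪outwardNormal D y, d⟫ < 0} with hB
  have := hD.isCompact_frontier.induction_on (p := fun s => volume (P '' (B ∩ s)) = 0)
    (by simp)
    (fun s t hst ht => measure_mono_null (Set.image_mono (Set.inter_subset_inter_right _ hst)) ht)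
    (fun s t hs ht => by
      rw [Set.inter_union_distrib_left, Set.image_union]
      exact measure_union_null hs ht)
    (fun y hy => ?_)
  · refine measure_mono_null (Set.image_mono ?_) this
    exact fun y hy => ⟨hy, hy.1⟩
  · obtain ⟨T, γ, U, h, hyU⟩ := hD.exists_chart hy
    refine ⟨U, mem_nhdsWithin_of_mem_nhds (h.isOpen.mem_nhds hyU), ?_⟩
    have hd0 : d ≠ 0 := by
      rintro rfl
      simp at hd
    have hnull := euclideanHausdorffMeasure_image_eq_zero P.lipschitz h.measure_nondiff
    rw [EuclideanSpace.euclideanHausdorffMeasure_eq_volume] at hnull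
    refine measure_mono_null ?_ (measure_union_null hnull
      (volume_image_tangential (T := T) (γ := γ) hd0 hP))
    rw [← Set.image_union]
    refine Set.image_mono ?_
    rintro z ⟨⟨hz, hray, hdark⟩, hzU⟩
    by_cases hdiff : DifferentiableAt ℝ γ (T z).fst
    · refine Or.inr ⟨(T z).fst, ⟨hdiff, ?_⟩, h.graphMap_fst hD.isOpen hzU hz⟩
      -- The ray gives `ν·d ≤ 0` and darkness gives `ν·d ≥ 0`, so only tangential points remain.
      have h1 := (h.isOutwardNormal hD.isOpen hzU hz hdiff).inner_nonpos hd hray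
      rw [h.outwardNormal_eq hD.isOpen hzU hz hdiff] at hdark
      have h2 := le_antisymm h1 (not_lt.1 hdark)
      rw [real_inner_smul_left, mul_eq_zero] at h2
      exact h2.resolve_left (inv_ne_zero (norm_ne_zero_iff.2 (graphNormal_ne_zero _)))
    · exact Or.inl ⟨(T z).fst, hdiff, h.graphMap_fst hD.isOpen hzU hz⟩

theorem exists_projection_along {d : E3} (hd : ‖d‖ = 1) :
    ∃ P : E3 →L[ℝ] E2, P d = 0 ∧ Function.Surjective P := by
  have hd0 : d ≠ 0 := by
    rintro rfl
    simp at hd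
  have : Fact (Module.finrank ℝ E3 = 2 + 1) := ⟨by simp⟩
  let b := OrthonormalBasis.fromOrthogonalSpanSingleton (𝕜 := ℝ) 2 hd0
  refine ⟨(b.repr.toContinuousLinearEquiv : _ →L[ℝ] E2) ∘L
    (Submodule.span ℝ {d})ᗮ.orthogonalProjectionOnto, ?_, ?_⟩
  · have h0 : (Submodule.span ℝ {d})ᗮ.orthogonalProjectionOnto d = 0 := by
      rw [Submodule.orthogonalProjectionOnto_eq_zero_iff, Submodule.orthogonal_orthogonal]
      exact Submodule.mem_span_singleton_self d
    simp [h0]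
  · refine b.repr.surjective.comp fun v => ⟨v, ?_⟩
    simp

/-- Going from a point of a bounded open set in direction `-d`, one reaches the boundary. -/
theorem IsObstacle.exists_exit {D : Set E3} (hD : IsObstacle D) {d z : E3} (hd : ‖d‖ = 1)
    (hz : z ∈ D) : ∃ r > 0, z - r • d ∈ frontier D ∧
      ∀ s : ℝ, 0 < s → s ≤ r → z - r • d + s • d ∈ D := by
  -- The exit time is the infimum of `A`, attained because `A` is closed.
  set A : Set ℝ := {r | 0 ≤ r ∧ z - r • d ∉ D} with hA
  have hcont : Continuous fun r : ℝ => z - r • d := by fun_prop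
  have hAc : IsClosed A := isClosed_Ici.inter (hD.isOpen.isClosed_compl.preimage hcont)
  have hAn : A.Nonempty := by
    obtain ⟨R, hR⟩ := hD.isBounded.exists_norm_le
    have hR0 : 0 ≤ R := (norm_nonneg z).trans (hR z hz)
    refine ⟨‖z‖ + R + 1, by positivity, fun hmem => ?_⟩
    have h1 := hR _ hmem
    have h2 := norm_sub_norm_le ((‖z‖ + R + 1) • d) z
    rw [norm_smul, hd, norm_sub_rev, Real.norm_of_nonneg (by positivity)] at h2
    linarith
  have hAb : BddBelow A := ⟨0, fun r hr => hr.1⟩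
  set r := sInf A with hr
  have hrA : r ∈ A := hAc.csInf_mem hAn hAb
  have hin : ∀ s, 0 ≤ s → s < r → z - s • d ∈ D := by
    intro s hs hsr
    by_contra hn
    exact notMem_of_lt_csInf hsr hAb ⟨hs, hn⟩
  have hr0 : 0 < r := by
    refine lt_of_le_of_ne hrA.1 fun h0 => hrA.2 ?_
    rwa [← h0, zero_smul, sub_zero]
  refine ⟨r, hr0, ⟨?_, fun h => hrA.2 (interior_subset h)⟩, fun s hs hsr => ?_⟩
  · have ht : Filter.Tendsto (fun s : ℝ => z - s • d) (𝓝[<] r) (𝓝 (z - r • d)) :=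
      (hcont.tendsto r).mono_left nhdsWithin_le_nhds
    refine mem_closure_of_tendsto ht ?_
    filter_upwards [Ioo_mem_nhdsLT hr0] with s hs using hin s hs.1.le hs.2
  · have := hin (r - s) (by linarith) (by linarith)
    rwa [sub_smul, ← sub_add] at this

/-- An illuminated part of the boundary with positive area lies behind every point of `D`. -/
theorem IsObstacle.measure_illuminated_ne_zero {D : Set E3} (hD : IsObstacle D) {d z : E3}
    (hd : ‖d‖ = 1) {c : ℝ} (hz : z ∈ D) (hzc : ⟪z, d⟫ < c) :
    (μHE[2] : Measure E3)
      {y | y ∈ frontier D ∧ ⟪y, d⟫ < c ∧ ⟪outwardNormal D y, d⟫ < 0} ≠ 0 := by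
  intro h0
  obtain ⟨P, hPd, hPs⟩ := exists_projection_along hd
  set W : Set E3 := D ∩ {y | ⟪y, d⟫ < c} with hW
  have hWo : IsOpen W := hD.isOpen.inter (isOpen_lt (by fun_prop) (by fun_prop))
  have hpos : 0 < volume (P '' W) :=
    ((P.isOpenMap hPs) W hWo).measure_pos _ ⟨P z, z, ⟨hz, hzc⟩, rfl⟩
  refine hpos.ne' ?_
  have hnull := euclideanHausdorffMeasure_image_eq_zero P.lipschitz h0
  rw [EuclideanSpace.euclideanHausdorffMeasure_eq_volume] at hnull
  refine measure_mono_null ?_ (measure_union_null hnull (hD.volume_image_dark hd hPd))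
  rw [← Set.image_union]
  rintro _ ⟨w, ⟨hwD, hwc⟩, rfl⟩
  obtain ⟨r, hr, hfr, hray⟩ := hD.exists_exit hd hwD
  -- The exit point has the same projection as `w`, and its height is smaller by `r`.
  refine ⟨w - r • d, ?_, by simp [hPd]⟩
  by_cases hν : ⟪outwardNormal D (w - r • d), d⟫ < 0
  · refine Or.inl ⟨hfr, ?_, hν⟩
    have hwc' : ⟪w, d⟫ < c := hwc
    rw [inner_sub_left, real_inner_smul_left, real_inner_self_eq_norm_sq, hd]
    linarith
  · exact Or.inr ⟨hfr, ⟨r, hr, hray⟩, hν⟩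

theorem norm_outwardNormal_le (D : Set E3) (y : E3) : ‖outwardNormal D y‖ ≤ 1 := by
  unfold outwardNormal
  split_ifs with h
  · exact h.choose_spec.1.le
  · simp

/-! ### The illumination measure and its transform -/

/-- The distribution along `d` of the projected illuminated area of `∂D`. -/
def illuminationMeasure (D : Set E3) (d : E3) : Measure ℝ :=
  (((μHE[2] : Measure E3).restrict (frontier D)).withDensity
    (fun y => ENNReal.ofReal (-⟪outwardNormal D y, d⟫))).map (fun y => ⟪y, d⟫)

section Illumination

variable {D : Set E3} {d : E3}

theorem measurable_inner_right (d : E3) : Measurable fun y : E3 => ⟪y, d⟫ :=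
  Continuous.measurable (by fun_prop)

theorem IsObstacle.aemeasurable_density (hD : IsObstacle D) :
    AEMeasurable (fun y => ENNReal.ofReal (-⟪outwardNormal D y, d⟫))
      ((μHE[2] : Measure E3).restrict (frontier D)) :=
  ((measurable_inner_right d).comp_aemeasurable hD.aemeasurable_outwardNormal).neg.ennreal_ofReal

theorem IsObstacle.isFiniteMeasure_illuminationMeasure (hD : IsObstacle D) (hd : ‖d‖ = 1) :
    IsFiniteMeasure (illuminationMeasure D d) := by
  have hfin : IsFiniteMeasure ((μHE[2] : Measure E3).restrict (frontier D)) :=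
    isFiniteMeasure_restrict.2 hD.measure_frontier_lt_top.ne
  have : IsFiniteMeasure (((μHE[2] : Measure E3).restrict (frontier D)).withDensity
      (fun y => ENNReal.ofReal (-⟪outwardNormal D y, d⟫))) := by
    refine isFiniteMeasure_withDensity (ne_top_of_le_ne_top (measure_ne_top
      ((μHE[2] : Measure E3).restrict (frontier D)) Set.univ) ?_)
    rw [← lintegral_one]
    refine lintegral_mono fun y => ?_
    rw [ENNReal.ofReal_le_one]
    have h1 := abs_real_inner_le_norm (outwardNormal D y) d
    rw [hd, mul_one] at h1
    linarith [neg_abs_le ⟪outwardNormal D y, d⟫, norm_outwardNormal_le D y]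
  unfold illuminationMeasure
  infer_instance

theorem IsObstacle.illuminationMeasure_eq_zero_iff (hD : IsObstacle D) {s : Set ℝ}
    (hs : MeasurableSet s) : illuminationMeasure D d s = 0 ↔ (μHE[2] : Measure E3)
      {y | y ∈ frontier D ∧ ⟪y, d⟫ ∈ s ∧ ⟪outwardNormal D y, d⟫ < 0} = 0 := by
  rw [illuminationMeasure, Measure.map_apply (measurable_inner_right d) hs,
    withDensity_apply_eq_zero' hD.aemeasurable_density,
    Measure.restrict_apply' isClosed_frontier.measurableSet]
  have : {y | ENNReal.ofReal (-⟪outwardNormal D y, d⟫) ≠ 0} ∩ (fun y => ⟪y, d⟫) ⁻¹' s ∩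
      frontier D = {y | y ∈ frontier D ∧ ⟪y, d⟫ ∈ s ∧ ⟪outwardNormal D y, d⟫ < 0} := by
    ext y
    simp
    tauto
  rw [this]

theorem IsObstacle.bddBelow_inner (hD : IsObstacle D) :
    BddBelow ((fun z => ⟪z, d⟫) '' D) := by
  obtain ⟨R, hR⟩ := hD.isBounded.exists_norm_le
  refine ⟨-(R * ‖d‖), ?_⟩
  rintro _ ⟨z, hz, rfl⟩
  have h1 := neg_le_of_abs_le (abs_real_inner_le_norm z d)
  have h2 := mul_le_mul_of_nonneg_right (hR z hz) (norm_nonneg d)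
  linarith

/-- The illumination measure starts at the minimal height of `D` along `d`. -/
theorem IsObstacle.illuminationMeasure_Iio_eq_zero_iff (hD : IsObstacle D) (hd : ‖d‖ = 1)
    {c : ℝ} : illuminationMeasure D d (Set.Iio c) = 0 ↔ c ≤ sInf ((fun z => ⟪z, d⟫) '' D) := by
  rw [hD.illuminationMeasure_eq_zero_iff measurableSet_Iio]
  constructor
  · intro h0
    by_contra! hlt
    obtain ⟨_, ⟨z, hz, rfl⟩, hzc⟩ := exists_lt_of_csInf_lt (hD.nonempty.image _) hlt
    exact hD.measure_illuminated_ne_zero hd hz hzc h0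
  · intro hc
    refine measure_mono_null ?_ measure_empty
    rintro y ⟨hy, hyc, -⟩
    have hclosed : IsClosed {y : E3 | c ≤ ⟪y, d⟫} := isClosed_le (by fun_prop) (by fun_prop)
    have hsub : D ⊆ {y : E3 | c ≤ ⟪y, d⟫} := fun z hz =>
      hc.trans (csInf_le hD.bddBelow_inner ⟨z, hz, rfl⟩)
    exact not_le.2 (Set.mem_Iio.1 hyc) (closure_minimal hsub hclosed hy.1)

/-- The measure is finite and carried by a bounded interval. This makes its `complexMGF` entire. -/
theorem IsObstacle.integrableExpSet_illuminationMeasure (hD : IsObstacle D) (hd : ‖d‖ = 1) :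
    ProbabilityTheory.integrableExpSet id (illuminationMeasure D d) = Set.univ := by
  have := hD.isFiniteMeasure_illuminationMeasure hd
  rw [Set.eq_univ_iff_forall]
  intro t
  obtain ⟨R, hR⟩ := hD.isBounded.closure.exists_norm_le
  have hae : ∀ᵐ x ∂illuminationMeasure D d, |x| ≤ R := by
    have hm : MeasurableSet {x : ℝ | |x| ≤ R}ᶜ :=
      (measurableSet_le (by fun_prop) (by fun_prop)).compl
    refine (hD.illuminationMeasure_eq_zero_iff hm).2 (measure_mono_null ?_ measure_empty)
    rintro y ⟨hy, hyR, -⟩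
    have h1 := abs_real_inner_le_norm y d
    rw [hd, mul_one] at h1
    exact hyR (h1.trans (hR y hy.1))
  refine Integrable.of_bound (by fun_prop) (Real.exp (|t| * R)) ?_
  filter_upwards [hae] with x hx
  rw [Real.norm_of_nonneg (Real.exp_pos _).le, Real.exp_le_exp]
  refine (le_abs_self _).trans ?_
  rw [abs_mul]
  exact mul_le_mul_of_nonneg_left hx (abs_nonneg t)

/-- At `z = 2ik` this is the integral in the backscattered far field. -/
theorem IsObstacle.complexMGF_illuminationMeasure (hD : IsObstacle D) (z : ℂ) :
    ProbabilityTheory.complexMGF id (illuminationMeasure D d) z =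
      ∫ y in frontier D, ((max (-⟪outwardNormal D y, d⟫) 0 : ℝ) : ℂ) *
        Complex.exp (z * (⟪y, d⟫ : ℝ)) ∂(μHE[2] : Measure E3) := by
  rw [illuminationMeasure,
    ProbabilityTheory.complexMGF_id_map (measurable_inner_right d).aemeasurable,
    ProbabilityTheory.complexMGF, integral_withDensity_eq_integral_toReal_smul₀
      hD.aemeasurable_density (by simp)]
  refine integral_congr_ae (Filter.Eventually.of_forall fun y => ?_)
  simp [ENNReal.toReal_ofReal', Complex.real_smul]

end Illumination

/-! ### Backscattering data and uniqueness -/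

/-- The backscattered far field has the direction of the polarization; its amplitude is an
oscillating integral over the illuminated part of the boundary. -/
theorem poFarField_neg_self (D : Set E3) {d p : E3} (hd : ‖d‖ = 1) (hpd : ⟪p, d⟫ = 0) (k : ℝ) :
    poFarField D (-d) d p k = (2 * Complex.I * k *
      ∫ y in frontier D, ((max (-⟪outwardNormal D y, d⟫) 0 : ℝ) : ℂ) *
        Complex.exp (2 * k * Complex.I * (⟪y, d⟫ : ℝ)) ∂(μHE[2] : Measure E3)) •
      toComplex p := by
  have hint : ∀ y : E3, Complex.exp (-(Complex.I * k * (⟪-d, y⟫ : ℝ))) •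
      (poCurrent D d p k y ⨯₃ toComplex (-d)) =
      (((max (-⟪outwardNormal D y, d⟫) 0 : ℝ) : ℂ) *
        Complex.exp (2 * k * Complex.I * (⟪y, d⟫ : ℝ))) •
        ((2 : ℂ) • (toComplex d ⨯₃ toComplex p)) := by
    intro y
    have hexp : Complex.exp (2 * k * Complex.I * (⟪y, d⟫ : ℝ)) =
        Complex.exp (-(Complex.I * k * (⟪-d, y⟫ : ℝ))) *
          Complex.exp (Complex.I * k * (⟪y, d⟫ : ℝ)) := by
      rw [← Complex.exp_add, inner_neg_left, real_inner_comm]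
      congr 1
      push_cast
      ring
    rw [hexp, poCurrent]
    split_ifs with h
    · rw [max_eq_left (by linarith), incidentH]
      generalize Complex.exp (-(Complex.I * k * (⟪-d, y⟫ : ℝ))) = a
      generalize Complex.exp (Complex.I * k * (⟪y, d⟫ : ℝ)) = b
      generalize outwardNormal D y = n
      ext i
      -- Coordinate form of `(ν × (d × p)) × (-d) = (-ν·d) (d × p)`.
      fin_cases i <;>
      · simp [toComplex, cross_apply, EuclideanSpace.inner_eq_star_dotProduct, dotProduct,
          Fin.sum_univ_three]
        ring
    · rw [max_eq_right (by linarith)]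
      simp
  have hd2 : d 0 * d 0 + d 1 * d 1 + d 2 * d 2 = 1 := by
    have h := real_inner_self_eq_norm_sq d
    rw [hd, EuclideanSpace.inner_eq_star_dotProduct] at h
    simpa [dotProduct, Fin.sum_univ_three] using h
  have hpd2 : d 0 * p 0 + d 1 * p 1 + d 2 * p 2 = 0 := by
    simpa [EuclideanSpace.inner_eq_star_dotProduct, dotProduct, Fin.sum_univ_three] using hpd
  have hd2' : (d 0 * d 0 + d 1 * d 1 + d 2 * d 2 : ℂ) = 1 := by
    simpa using congrArg Complex.ofReal hd2
  have hpd2' : (d 0 * p 0 + d 1 * p 1 + d 2 * p 2 : ℂ) = 0 := by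
    simpa using congrArg Complex.ofReal hpd2
  rw [poFarField]
  simp_rw [hint]
  rw [integral_smul_const]
  generalize (∫ y in frontier D, ((max (-⟪outwardNormal D y, d⟫) 0 : ℝ) : ℂ) *
        Complex.exp (2 * k * Complex.I * (⟪y, d⟫ : ℝ)) ∂(μHE[2] : Measure E3)) = F
  -- Coordinate form of `(-d) × (d × p) = (d·d) p - (d·p) d`, which equals `p` here.
  ext i
  fin_cases i
  · simp [toComplex, cross_apply]
    linear_combination (2 * Complex.I * k * F * p 0) * hd2' - (2 * Complex.I * k * F * d 0) * hpd2'
  · simp [toComplex, cross_apply]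
    linear_combination (2 * Complex.I * k * F * p 1) * hd2' - (2 * Complex.I * k * F * d 1) * hpd2'
  · simp [toComplex, cross_apply]
    linear_combination (2 * Complex.I * k * F * p 2) * hd2' - (2 * Complex.I * k * F * d 2) * hpd2'

/-- The backscattering data for one incident direction determine the minimal height of the
obstacle in that direction. -/
theorem sInf_inner_eq_of_backscattering {kmin kmax : ℝ} (hkmin : 0 < kmin) (hk : kmin < kmax)
    {d p e : E3} (hd : ‖d‖ = 1) (hpd : ⟪p, d⟫ = 0) (hep : ⟪e, p⟫ ≠ 0)
    {D₁ D₂ : Set E3} (hD₁ : IsObstacle D₁) (hD₂ : IsObstacle D₂)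
    (hback : ∀ k ∈ Set.Icc kmin kmax,
      toComplex e ⬝ᵥ poFarField D₁ (-d) d p k = toComplex e ⬝ᵥ poFarField D₂ (-d) d p k) :
    sInf ((fun z => ⟪z, d⟫) '' D₁) = sInf ((fun z => ⟪z, d⟫) '' D₂) := by
  have hfin₁ := hD₁.isFiniteMeasure_illuminationMeasure hd
  have hfin₂ := hD₂.isFiniteMeasure_illuminationMeasure hd
  have hep' : toComplex e ⬝ᵥ toComplex p ≠ 0 := by
    have : toComplex e ⬝ᵥ toComplex p = ((⟪e, p⟫ : ℝ) : ℂ) := by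
      simp [toComplex, EuclideanSpace.inner_eq_star_dotProduct, dotProduct, Fin.sum_univ_three]
      ring
    rw [this]
    exact_mod_cast hep
  have heq : ∀ k ∈ Set.Icc kmin kmax,
      ProbabilityTheory.complexMGF id (illuminationMeasure D₁ d) (2 * k * Complex.I) =
      ProbabilityTheory.complexMGF id (illuminationMeasure D₂ d) (2 * k * Complex.I) := by
    intro k hkK
    have h := hback k hkK
    rw [poFarField_neg_self D₁ hd hpd, poFarField_neg_self D₂ hd hpd, dotProduct_smul,
      dotProduct_smul, smul_eq_mul, smul_eq_mul] at h
    have hk0 : (2 * Complex.I * k : ℂ) ≠ 0 := by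
      have : k ≠ 0 := (hkmin.trans_le hkK.1).ne'
      simp [this]
    rw [hD₁.complexMGF_illuminationMeasure, hD₂.complexMGF_illuminationMeasure]
    exact mul_left_cancel₀ hk0 (mul_right_cancel₀ hep' h)
  have han : ∀ {D : Set E3}, IsObstacle D →
      AnalyticOnNhd ℂ (ProbabilityTheory.complexMGF id (illuminationMeasure D d)) Set.univ := by
    intro D hD z _
    apply ProbabilityTheory.analyticAt_complexMGF
    rw [hD.integrableExpSet_illuminationMeasure hd]
    simp
  -- The identity theorem only needs agreement at points accumulating at `2i kmin`; they are
  -- supplied by `k` decreasing to `kmin`.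
  have hfreq : ∃ᶠ z in 𝓝[≠] (2 * kmin * Complex.I : ℂ),
      ProbabilityTheory.complexMGF id (illuminationMeasure D₁ d) z =
      ProbabilityTheory.complexMGF id (illuminationMeasure D₂ d) z := by
    have ht : Filter.Tendsto (fun k : ℝ => (2 * k * Complex.I : ℂ)) (𝓝[>] kmin)
        (𝓝[≠] (2 * kmin * Complex.I : ℂ)) := by
      refine tendsto_nhdsWithin_iff.2 ⟨?_, ?_⟩
      · exact (Continuous.tendsto (by fun_prop) kmin).mono_left nhdsWithin_le_nhds
      · filter_upwards [self_mem_nhdsWithin] with k hkk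
        simpa using (Set.mem_Ioi.1 hkk).ne'
    refine ht.frequently (Filter.Eventually.frequently ?_)
    filter_upwards [Ioc_mem_nhdsGT hk] with k hkk using heq k ⟨hkk.1.le, hkk.2⟩
  have hmeas : illuminationMeasure D₁ d = illuminationMeasure D₂ d :=
    Measure.ext_of_complexMGF_id_eq ((han hD₁).eq_of_frequently_eq (han hD₂) hfreq)
  apply le_antisymm
  · rw [← hD₂.illuminationMeasure_Iio_eq_zero_iff hd, ← hmeas,
      hD₁.illuminationMeasure_Iio_eq_zero_iff hd]
  · rw [← hD₁.illuminationMeasure_Iio_eq_zero_iff hd, hmeas,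
      hD₂.illuminationMeasure_Iio_eq_zero_iff hd]

theorem sSup_inner_eq_neg_sInf (D : Set E3) (d : E3) :
    sSup ((fun z => ⟪z, d⟫) '' D) = -sInf ((fun z => ⟪z, -d⟫) '' D) := by
  rw [Real.sInf_def, neg_neg, ← Set.image_neg_eq_neg, Set.image_image]
  simp

end PhysicalOptics

end

theorem corollary4p2
    (kmin kmax : ℝ) (hkmin : 0 < kmin) (hk : kmin < kmax)
    (d p e : PhysicalOptics.E3) (hd : ‖d‖ = 1) (hp : ‖p‖ = 1) (he : ‖e‖ = 1)
    (hpd : inner ℝ p d = 0) (hep : inner ℝ e p ≠ 0)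
    (D₁ D₂ : Set PhysicalOptics.E3)
    (hD₁ : PhysicalOptics.IsObstacle D₁) (hD₂ : PhysicalOptics.IsObstacle D₂)
    (hback : ∀ k ∈ Set.Icc kmin kmax,
      PhysicalOptics.toComplex e ⬝ᵥ PhysicalOptics.poFarField D₁ (-d) d p k =
        PhysicalOptics.toComplex e ⬝ᵥ PhysicalOptics.poFarField D₂ (-d) d p k)
    (hback' : ∀ k ∈ Set.Icc kmin kmax,
      PhysicalOptics.toComplex e ⬝ᵥ PhysicalOptics.poFarField D₁ d (-d) p k =
        PhysicalOptics.toComplex e ⬝ᵥ PhysicalOptics.poFarField D₂ d (-d) p k) :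
    PhysicalOptics.strip D₁ d = PhysicalOptics.strip D₂ d := by
  have h1 := PhysicalOptics.sInf_inner_eq_of_backscattering hkmin hk hd hpd hep hD₁ hD₂ hback
  -- The infimum in direction `-d` is minus the supremum in direction `d`.
  have h2 := PhysicalOptics.sInf_inner_eq_of_backscattering (d := -d) hkmin hk
    (by rwa [norm_neg]) (by rw [inner_neg_right, hpd, neg_zero]) hep hD₁ hD₂
    (by simpa only [neg_neg] using hback')
  rw [PhysicalOptics.strip, PhysicalOptics.strip, h1, PhysicalOptics.sSup_inner_eq_neg_sInf,
    PhysicalOptics.sSup_inner_eq_neg_sInf D₂, h2]
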